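/- For an integer $n\ge 0$ and real $t$ let $$L_n(t)=\frac{1}{n!}\,e^{t}\left(\frac{d}{dt}\right)^{n}\bigl(e^{-t}t^{n}\bigr)$$ be the classical Laguerre polynomial, and let $$Q_n(t)=\sum_{k=0}^{n}k!\binom{n}{k}^{2}(-t)^{k}.$$ Then for all $n\ge 0$ we have $$|L_n(1)|\le 1,$$ which is equivalent to $$|Q_n(1)|\le n!.$$ -/

import Mathlib

/-- The classical Laguerre polynomial as a function of a real variable, given by the Rodrigues
formula `L_n(t) = (1 / n!) e^t (d/dt)^n (e^{-t} t^n)`. The differentiated function is smooth on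
all of `ℝ`, so the iterated derivative is the genuine one. -/
noncomputable def laguerreL (n : ℕ) (t : ℝ) : ℝ :=
  1 / (Nat.factorial n : ℝ) * Real.exp t *
    iteratedDeriv n (fun s : ℝ => Real.exp (-s) * s ^ n) t

/-- The denominator polynomial `Q_n(t) = ∑_{k=0}^{n} k! (n choose k)^2 (-t)^k` in the Padé identity
of the factorial series, as a function of a real variable. -/
noncomputable def padeQ (n : ℕ) (t : ℝ) : ℝ :=
  ∑ k ∈ Finset.range (n + 1), (Nat.factorial k : ℝ) * (Nat.choose n k : ℝ) ^ 2 * (-t) ^ k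

/-! At t = 1 put y = L_n and s = -L_n' = `laguerreSumShift n n 1`. One step of the recurrence is s'
= s + y, m(y' - y) = -s' with m = n + 1, and it preserves y² + (s² + ys)/m exactly. Only the passage
from m to m + 1 changes this energy, and since s² + ys ≥ -y²/4 ≥ -1/4 while |y| ≤ 1, it grows by at
most (1/m - 1/(m+1))/4. These increments telescope, so the energy stays below 3/4, which in turn
forces |y| ≤ 1 (`energy_step`). Reversing the sum for Q_n gives |Q_n(1)| = n! |L_n(1)|. -/

/-- The explicit polynomial `∑ (n choose k) (-t)^k / k!`, with `N` terms. -/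
noncomputable def laguerreSum (N n : ℕ) (t : ℝ) : ℝ :=
  ∑ k ∈ Finset.range N, (n.choose k : ℝ) * ((-t) ^ k / (k.factorial : ℝ))

/-- The companion sum `∑ (n choose (k + 1)) (-t)^k / k!`, with `N` terms. -/
noncomputable def laguerreSumShift (N n : ℕ) (t : ℝ) : ℝ :=
  ∑ k ∈ Finset.range N, (n.choose (k + 1) : ℝ) * ((-t) ^ k / (k.factorial : ℝ))

theorem laguerreSum_eq_of_lt {N n : ℕ} (h : n < N) (t : ℝ) :
    laguerreSum N n t = laguerreSum (n + 1) n t := by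
  unfold laguerreSum
  symm
  apply Finset.sum_subset
  · intro x hx
    simp only [Finset.mem_range] at hx ⊢
    omega
  · intro x _ hx
    simp only [Finset.mem_range, not_lt] at hx
    rw [Nat.choose_eq_zero_of_lt (by omega)]
    simp

theorem laguerreSumShift_eq_of_le {N n : ℕ} (h : n ≤ N) (t : ℝ) :
    laguerreSumShift N n t = laguerreSumShift n n t := by
  unfold laguerreSumShift
  symm
  apply Finset.sum_subset
  · intro x hx
    simp only [Finset.mem_range] at hx ⊢
    omega
  · intro x _ hx
    simp only [Finset.mem_range, not_lt] at hx
    rw [Nat.choose_eq_zero_of_lt (by omega)]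
    simp

theorem laguerreSumShift_succ (N n : ℕ) (t : ℝ) :
    laguerreSumShift N (n + 1) t = laguerreSumShift N n t + laguerreSum N n t := by
  unfold laguerreSumShift laguerreSum
  rw [← Finset.sum_add_distrib]
  refine Finset.sum_congr rfl fun k _ => ?_
  rw [Nat.choose_succ_succ']
  push_cast
  ring

/-- The constant terms cancel; Pascal's rule and the absorption identity (n+1) C(n,k) = (k+1)
C(n+1,k+1) match the rest termwise. -/
theorem laguerreSum_succ (N n : ℕ) (t : ℝ) :
    (n + 1 : ℝ) * (laguerreSum (N + 1) (n + 1) t - laguerreSum (N + 1) n t) =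
      -t * laguerreSumShift N (n + 1) t := by
  unfold laguerreSumShift laguerreSum
  rw [← Finset.sum_sub_distrib, Finset.sum_range_succ', mul_add, Finset.mul_sum, Finset.mul_sum]
  simp only [Nat.choose_zero_right, sub_self, mul_zero, add_zero]
  refine Finset.sum_congr rfl fun k _ => ?_
  have h : ((n : ℝ) + 1) * n.choose k = (n + 1).choose (k + 1) * (k + 1) := by
    exact_mod_cast Nat.add_one_mul_choose_eq n k
  have hk : ((k : ℝ) + 1) ≠ 0 := by positivity
  have hf : (k.factorial : ℝ) ≠ 0 := by positivity
  rw [Nat.factorial_succ, pow_succ]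
  have h2 : ((n + 1).choose (k + 1) : ℝ) = n.choose k + n.choose (k + 1) := by
    rw [Nat.choose_succ_succ']
    push_cast
    ring
  have h3 : ((n + 1).choose (k + 1) : ℝ) - n.choose (k + 1) = n.choose k := by linarith
  rw [← sub_mul, h3, ← mul_assoc, h]
  push_cast
  field_simp

theorem iteratedDeriv_exp_neg (i : ℕ) (t : ℝ) :
    iteratedDeriv i (fun s : ℝ => Real.exp (-s)) t = (-1) ^ i * Real.exp (-t) := by
  rw [iteratedDeriv_comp_neg, iteratedDeriv_eq_iterate, Real.iter_deriv_exp, smul_eq_mul]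

theorem laguerreL_eq_laguerreSum (n : ℕ) (t : ℝ) :
    laguerreL n t = laguerreSum (n + 1) n t := by
  have h1 : ContDiffAt ℝ n (fun s : ℝ => Real.exp (-s)) t := by fun_prop
  have h2 : ContDiffAt ℝ n (fun s : ℝ => s ^ n) t := by fun_prop
  unfold laguerreL laguerreSum
  rw [iteratedDeriv_fun_mul h1 h2, Finset.mul_sum]
  refine Finset.sum_congr rfl fun k hk => ?_
  have hkn : k ≤ n := Nat.lt_succ_iff.mp (Finset.mem_range.mp hk)
  have hd : (k.factorial : ℝ) * n.descFactorial (n - k) = n.factorial := by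
    have := Nat.factorial_mul_descFactorial (Nat.sub_le n k)
    rw [Nat.sub_sub_self hkn] at this
    exact_mod_cast this
  rw [iteratedDeriv_exp_neg, iteratedDeriv_pow, Nat.sub_sub_self hkn,
    neg_pow t k, ← hd]
  have he : Real.exp t * Real.exp (-t) = 1 := by rw [← Real.exp_add]; simp
  have hk0 : (k.factorial : ℝ) ≠ 0 := by positivity
  have hd0 : (n.descFactorial (n - k) : ℝ) ≠ 0 := by
    intro h0
    rw [h0, mul_zero] at hd
    exact absurd hd.symm (by positivity)
  field_simp
  linear_combination ((n.choose k : ℝ) * t ^ k) * he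

theorem padeQ_one_eq (n : ℕ) :
    padeQ n 1 = (n.factorial : ℝ) * (-1) ^ n * laguerreL n 1 := by
  rw [laguerreL_eq_laguerreSum]
  unfold padeQ laguerreSum
  rw [← Finset.sum_range_reflect, Finset.mul_sum]
  refine Finset.sum_congr rfl fun k hk => ?_
  have hkn : k ≤ n := Nat.lt_succ_iff.mp (Finset.mem_range.mp hk)
  have e : n + 1 - 1 - k = n - k := by omega
  have hc : (n.choose k : ℝ) * k.factorial * (n - k).factorial = n.factorial := by
    exact_mod_cast Nat.choose_mul_factorial_mul_factorial hkn
  have hs : (-1 : ℝ) ^ n = (-1) ^ (n - k) * (-1) ^ k := by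
    rw [← pow_add, Nat.sub_add_cancel hkn]
  have hs2 : (-1 : ℝ) ^ k * (-1) ^ k = 1 := by rw [← mul_pow]; norm_num
  have hk0 : (k.factorial : ℝ) ≠ 0 := by positivity
  rw [e, Nat.choose_symm hkn, ← hc, hs]
  field_simp
  linear_combination (-(n.choose k : ℝ) ^ 2) * hs2

/-- Recurrence in first-order form, with `n (L_n - L_{n-1}) = -t * laguerreSumShift n n t`. -/
theorem laguerreL_succ (n : ℕ) (t : ℝ) :
    (n + 1 : ℝ) * (laguerreL (n + 1) t - laguerreL n t) =
      -t * (laguerreSumShift n n t + laguerreL n t) := by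
  have h := laguerreSum_succ (n + 1) n t
  rw [laguerreSum_eq_of_lt (N := n + 1 + 1) (n := n) (by omega), laguerreSumShift_succ,
    laguerreSumShift_eq_of_le (N := n + 1) (n := n) (by omega)] at h
  simpa only [laguerreL_eq_laguerreSum] using h

theorem laguerreSumShift_diag_succ (n : ℕ) (t : ℝ) :
    laguerreSumShift (n + 1) (n + 1) t = laguerreSumShift n n t + laguerreL n t := by
  rw [laguerreSumShift_succ, laguerreSumShift_eq_of_le (N := n + 1) (n := n) (by omega),
    laguerreL_eq_laguerreSum]

/-- One step of the energy estimate for the recurrence `m (y' - y) = -(s + y)`, `s' = s + y`. -/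
theorem energy_step {m y s y' s' : ℝ} (hm : 2 ≤ m) (hs : s' = s + y) (hy : m * (y' - y) = -s')
    (hE : y ^ 2 + (s ^ 2 + y * s) / m ≤ 3 / 4 - 1 / (4 * m)) :
    y' ^ 2 ≤ 1 ∧ y' ^ 2 + (s' ^ 2 + y' * s') / (m + 1) ≤ 3 / 4 - 1 / (4 * (m + 1)) := by
  have hm0 : 0 < m := by linarith
  -- Both y² - y'² and the difference of the quadratic terms over m equal s'(y + y')/m.
  have hcons : y' ^ 2 + (s' ^ 2 + y' * s') / m = y ^ 2 + (s ^ 2 + y * s) / m := by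
    have h1 : y = y' + s' / m := by field_simp; linarith
    have h2 : s = s' - y := by linarith
    rw [h2, h1]
    field_simp
    ring
  have hq : -(y' ^ 2) / 4 ≤ s' ^ 2 + y' * s' := by nlinarith [sq_nonneg (s' + y' / 2)]
  have hle : y' ^ 2 + (-(y' ^ 2) / 4) / m ≤ 3 / 4 - 1 / (4 * m) := by
    rw [← hcons] at hE
    have := div_le_div_of_nonneg_right hq hm0.le
    linarith
  -- As m ≥ 2, the left side of `hle` is at least (7/8) y'², so y'² ≤ 6/7.
  have hy1 : y' ^ 2 ≤ 1 := by
    have h3 : (y' ^ 2 / 4) / m ≤ (y' ^ 2 / 4) / 2 :=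
      div_le_div_of_nonneg_left (by positivity) (by norm_num) hm
    have h4 : 0 ≤ 1 / (4 * m) := by positivity
    have h5 : (-(y' ^ 2) / 4) / m = -((y' ^ 2 / 4) / m) := by ring
    rw [h5] at hle
    linarith
  refine ⟨hy1, ?_⟩
  rw [← hcons] at hE
  have hδ : 0 ≤ 1 / m - 1 / (m + 1) :=
    sub_nonneg.mpr (one_div_le_one_div_of_le hm0 (by linarith))
  have hq' : 0 ≤ s' ^ 2 + y' * s' + 1 / 4 := by linarith
  have hmul := mul_nonneg hδ hq'
  have e1 : 1 / (4 * m) = 1 / m / 4 := by field_simp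
  have e2 : 1 / (4 * (m + 1)) = 1 / (m + 1) / 4 := by field_simp
  rw [e1, div_eq_mul_one_div _ m] at hE
  rw [e2, div_eq_mul_one_div _ (m + 1)]
  linarith

theorem laguerreL_zero (t : ℝ) : laguerreL 0 t = 1 := by
  simp [laguerreL_eq_laguerreSum, laguerreSum]

theorem laguerreL_one_one : laguerreL 1 1 = 0 := by
  simp [laguerreL_eq_laguerreSum, laguerreSum, Finset.sum_range_succ]

theorem laguerreL_sq_le_one_and_energy_le (n : ℕ) :
    laguerreL (n + 1) 1 ^ 2 ≤ 1 ∧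
      laguerreL (n + 1) 1 ^ 2 + (laguerreSumShift (n + 1) (n + 1) 1 ^ 2 +
        laguerreL (n + 1) 1 * laguerreSumShift (n + 1) (n + 1) 1) / (n + 2 : ℝ) ≤
        3 / 4 - 1 / (4 * (n + 2 : ℝ)) := by
  induction n with
  | zero =>
    -- The induction starts at L_1 = 0, s = 1, m = 2, where the energy is 1/2 ≤ 5/8; at L_0 the
    -- energy 1 would exceed the bound 1/2.
    norm_num [laguerreL_one_one, laguerreSumShift]
  | succ n ih =>
    have h := energy_step (m := (n : ℝ) + 2) (by linarith [(Nat.cast_nonneg n : (0 : ℝ) ≤ n)])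
      (laguerreSumShift_diag_succ (n + 1) 1) (y' := laguerreL (n + 1 + 1) 1)
      (by
        have := laguerreL_succ (n + 1) 1
        rw [laguerreSumShift_diag_succ (n + 1) 1]
        push_cast at this
        linarith) ih.2
    have e : (n : ℝ) + 2 + 1 = (n + 1 : ℕ) + 2 := by push_cast; ring
    rwa [e] at h

theorem abs_laguerreL_one_le (n : ℕ) : |laguerreL n 1| ≤ 1 := by
  cases n with
  | zero => simp [laguerreL_zero]
  | succ n => exact (sq_le_one_iff_abs_le_one _).mp (laguerreL_sq_le_one_and_energy_le n).1

theorem abs_padeQ_one (n : ℕ) : |padeQ n 1| = (n.factorial : ℝ) * |laguerreL n 1| := by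
  rw [padeQ_one_eq, abs_mul, abs_mul, abs_pow, abs_neg, abs_one, one_pow, mul_one, Nat.abs_cast]

theorem theorem3 (n : ℕ) :
    |laguerreL n 1| ≤ 1 ∧
    |padeQ n 1| ≤ (Nat.factorial n : ℝ) ∧
    (|laguerreL n 1| ≤ 1 ↔ |padeQ n 1| ≤ (Nat.factorial n : ℝ)) := by
  have hiff : |laguerreL n 1| ≤ 1 ↔ |padeQ n 1| ≤ (Nat.factorial n : ℝ) := by
    rw [abs_padeQ_one, mul_le_iff_le_one_right (by positivity)]
  exact ⟨abs_laguerreL_one_le n, hiff.mp (abs_laguerreL_one_le n), hiff⟩
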